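/- Let $T>0$, $\sigma_c>0$, and let $x(t)$, $t\in[0,T]$, be a zero-mean complex-valued (jointly measurable, second-order) random process whose autocorrelation function $R_X(t,\eta)=\mathbb{E}[x(t)\overline{x(\eta)}]$ is jointly continuous on $[0,T]^2$. Write $L_2=L_2[0,T]$ for the space of complex-valued square-integrable functions, with $\langle f,g\rangle=\int_0^T f(t)\overline{g(t)}\,dt$. Let $w$ be a white noise process of level $\sigma_c^2$ (not necessarily Gaussian), that is, a family of square-integrable zero-mean random variables $\langle w,f\rangle$, $f\in L_2$, with $\mathbb{E}\big[\langle w,f\rangle\overline{\langle w,g\rangle}\big]=\sigma_c^2\,\overline{\langle f,g\rangle}$ for all $f,g\in L_2$. Assume that $w$ is uncorrelated with $x$, i.e. each $\langle w,f\rangle$ is uncorrelated with each $x(t)$. Let $y=x+w$, so that $\langle y,s\rangle=\int_0^T x(t)\overline{s(t)}\,dt+\langle w,s\rangle$ for $s\in L_2$. Then there are orthonormal eigenfunctions $\psi_1,\psi_2,\ldots\in L_2$ with eigenvalues $\lambda_1\ge\lambda_2\ge\cdots$ of $R_X$, i.e. $\int_0^T R_X(t,\eta)\psi_k(\eta)\,d\eta=\lambda_k\psi_k(t)$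 for almost every $t$, which are complete in the sense that $\int_0^T R_X(\cdot,\eta)f(\eta)\,d\eta=0$ almost everywhere for every $f\in L_2$ orthogonal to all $\psi_k$. For every such choice of $(\psi_k,\lambda_k)_{k\ge1}$ and every $N$, among all estimates of $x$ of the form $$\hat x(t)=\sum_{n=1}^N v_n(t)\,\langle y,s_n\rangle,\qquad s_1,\ldots,s_N,v_1,\ldots,v_N\in L_2,$$ the mean-squared error $\mathbb{E}\int_0^T|\hat x(t)-x(t)|^2\,dt$ is minimized, with a finite minimum, by $$s_n=\frac{\psi_n}{\sqrt{\lambda_n+\sigma_c^2}},\qquad v_n=\frac{\lambda_n\,\psi_n}{\sqrt{\lambda_n+\sigma_c^2}},\qquad n=1,\ldots,N.$$ -/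

import Mathlib

open MeasureTheory Set

open scoped ENNReal ComplexConjugate

noncomputable section

namespace LinearSampling

/-- Lebesgue measure on the interval `[0, T]`. -/
abbrev timeMeasure (T : ℝ) : Measure ℝ := volume.restrict (Icc 0 T)

/-- The complex Hilbert space `L₂[0, T]`. Mathlib's `inner ℂ f g` is `∫ conj (f t) * g t dt`,
the conjugate of the inner product `⟨f, g⟩ = ∫ f t * conj (g t) dt` of signal processing. -/
abbrev SignalSpace (T : ℝ) : Type := Lp ℂ 2 (timeMeasure T)

variable {Ω : Type*} [MeasurableSpace Ω]

/-- The autocorrelation function `R_X(t, η) = E[x(t) x(η)*]` of a random process. -/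
def autocorrelation (P : Measure Ω) (x : ℝ → Ω → ℂ) (t η : ℝ) : ℂ :=
  ∫ ω, x t ω * conj (x η ω) ∂P

/-- A zero-mean second-order random process on `[0, T]` whose autocorrelation function is jointly
continuous. The values `x t` for `t` outside `[0, T]` play no role. -/
structure IsContinuousCovarianceProcess (P : Measure Ω) (T : ℝ) (x : ℝ → Ω → ℂ) : Prop where
  aestronglyMeasurable :
    AEStronglyMeasurable (fun p : ℝ × Ω => x p.1 p.2) ((timeMeasure T).prod P)
  memLp : ∀ t ∈ Icc (0 : ℝ) T, MemLp (x t) 2 P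
  mean_zero : ∀ t ∈ Icc (0 : ℝ) T, ∫ ω, x t ω ∂P = 0
  continuousOn_autocorrelation :
    ContinuousOn (fun p : ℝ × ℝ => autocorrelation P x p.1 p.2) (Icc 0 T ×ˢ Icc 0 T)

/-- White noise of level `σ ^ 2` on `[0, T]` (not necessarily Gaussian). As white noise has no
pointwise values, it is given through its inner products with signals: `w f` is the random variable
`⟨w, f⟩ = ∫ w(t) f(t)* dt`. These variables have mean zero and satisfy
`E[⟨w, f⟩ ⟨w, g⟩*] = σ ^ 2 * ∫ f(t)* g(t) dt`. -/
structure IsWhiteNoise (P : Measure Ω) (T σ : ℝ) (w : SignalSpace T → Ω → ℂ) : Prop where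
  memLp : ∀ f, MemLp (w f) 2 P
  mean_zero : ∀ f, ∫ ω, w f ω ∂P = 0
  covariance : ∀ f g, ∫ ω, w f ω * conj (w g ω) ∂P = (σ : ℂ) ^ 2 * inner ℂ f g

/-- Two complex random variables are uncorrelated: `E[X Y*] = E[X] E[Y]*`. -/
def Uncorrelated (P : Measure Ω) (X Y : Ω → ℂ) : Prop :=
  ∫ ω, X ω * conj (Y ω) ∂P = (∫ ω, X ω ∂P) * conj (∫ ω, Y ω ∂P)

/-- The sample `⟨y, s⟩ = ⟨x, s⟩ + ⟨w, s⟩` of the noisy signal `y = x + w`. -/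
def noisySample {T : ℝ} (x : ℝ → Ω → ℂ) (w : SignalSpace T → Ω → ℂ) (s : SignalSpace T)
    (ω : Ω) : ℂ :=
  (∫ t, x t ω * conj (s t) ∂(timeMeasure T)) + w s ω

/-- The linear estimate `x̂(t) = ∑ n, ⟨y, s n⟩ * v n t` with sampling functions `s n` and
reconstruction functions `v n`. -/
def linearEstimate {T : ℝ} {N : ℕ} (x : ℝ → Ω → ℂ) (w : SignalSpace T → Ω → ℂ)
    (s v : Fin N → SignalSpace T) (t : ℝ) (ω : Ω) : ℂ :=
  ∑ n, noisySample x w (s n) ω * v n t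

/-- The mean-squared error `E[∫₀ᵀ |x̂(t) - x(t)|² dt]`, as an extended nonnegative number. -/
def meanSquaredError {T : ℝ} {N : ℕ} (P : Measure Ω) (x : ℝ → Ω → ℂ)
    (w : SignalSpace T → Ω → ℂ) (s v : Fin N → SignalSpace T) : ℝ≥0∞ :=
  ∫⁻ ω, ∫⁻ t, ‖linearEstimate x w s v t ω - x t ω‖ₑ ^ 2 ∂(timeMeasure T) ∂P

/-- `ψ 0, ψ 1, …` and `lam 0 ≥ lam 1 ≥ …` are the eigenfunctions and eigenvalues of the integral
operator on `L₂[0, T]` with kernel `R`, in decreasing order: the `ψ k` are orthonormal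
eigenfunctions with eigenvalues `lam k`, and no part of the operator is left out, i.e. it vanishes
on the functions orthogonal to all `ψ k`. (An operator with infinitely many positive eigenvalues
may also have a kernel, whose elements then cannot be listed in decreasing order after them;
so the `ψ k` are not required to span the kernel.) -/
structure IsOrderedEigensystem (T : ℝ) (R : ℝ → ℝ → ℂ) (ψ : ℕ → SignalSpace T)
    (lam : ℕ → ℝ) : Prop where
  orthonormal : Orthonormal ℂ ψ
  eigen : ∀ k, ∀ᵐ t ∂(timeMeasure T), ∫ η, R t η * ψ k η ∂(timeMeasure T) = lam k * ψ k t
  antitone : Antitone lam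
  complete : ∀ f : SignalSpace T, (∀ k, inner ℂ (ψ k) f = 0) →
    ∀ᵐ t ∂(timeMeasure T), ∫ η, R t η * f η ∂(timeMeasure T) = 0

/-- The sampling functions `s n = ψ n / √(lam n + σ ^ 2)`. -/
def optimalSampling {T : ℝ} (σ : ℝ) (ψ : ℕ → SignalSpace T) (lam : ℕ → ℝ) (N : ℕ)
    (n : Fin N) : SignalSpace T :=
  ((1 / √(lam n + σ ^ 2) : ℝ) : ℂ) • ψ n

/-- The reconstruction functions `v n = lam n * ψ n / √(lam n + σ ^ 2)`. -/
def optimalReconstruction {T : ℝ} (σ : ℝ) (ψ : ℕ → SignalSpace T) (lam : ℕ → ℝ) (N : ℕ)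
    (n : Fin N) : SignalSpace T :=
  ((lam n / √(lam n + σ ^ 2) : ℝ) : ℂ) • ψ n

end LinearSampling

end

/-! Only second moments enter the error. Let `K` be the integral operator with kernel `R_X`. The
noisy samples have covariance `K + σ²`, and their correlation with `x` is given by `K`, so the error
is the mean energy of `x` plus a quadratic expression in `s` and `v` (`meanSquaredError_eq`,
`excessError`). Replace the `s n` by a basis `u j` of their span, orthonormal for the form `K + σ²`,
and adapt the `v n` accordingly. The expression splits into terms `‖v' j‖² - 2 Re ⟪K (u j), v' j⟫ ≥
-‖K (u j)‖²` (`neg_sum_le_excessError`). In terms of the eigenvectors, `∑ j, ‖K (u j)‖²` puts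
weights on the numbers `l k² / (l k + σ²)`. By Bessel's inequality, used in both directions, each
weight is at most 1 and they total at most `N`. These numbers decrease with `k`, so the sum is at
most that of the first `N` (`sum_norm_apply_sq_le`). The stated choice attains this bound
(`excessError_optimal`). For the existence of eigenfunctions, factor `K = L† ∘ L` with `L f = ⟨x,
f⟩*`. Bessel's inequality on each path bounds `∑ ‖L e‖²` by the mean energy, so `L` is
Hilbert–Schmidt and `K` compact. Taking a top eigenvector of `K` on successive orthogonal
complements gives the sequence (`exists_antitone_eigensystem`). -/

noncomputable section

namespace LinearSampling

/-! ### Hilbert–Schmidt maps and decreasing eigensystems. -/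

section Hilbert

open ContinuousLinearMap Filter Topology

open scoped ComplexOrder

variable {H E : Type*} [NormedAddCommGroup H] [InnerProductSpace ℂ H]
  [NormedAddCommGroup E] [InnerProductSpace ℂ E]

/-- A linear map with `∑ ‖L e‖ ^ 2` bounded over finite orthonormal sets is small on the orthogonal
complement of some finite set. -/
theorem exists_finset_norm_apply_sq_le (L : H →L[ℂ] E) {τ : ℝ}
    (hτ : ∀ s : Finset H, Orthonormal ℂ ((↑) : s → H) → ∑ e ∈ s, ‖L e‖ ^ 2 ≤ τ)
    {ε : ℝ} (hε : 0 < ε) :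
    ∃ s : Finset H, ∀ f : H, (∀ e ∈ s, inner ℂ e f = 0) → ‖L f‖ ^ 2 ≤ ε * ‖f‖ ^ 2 := by
  classical
  let S : Set ℝ := {r | ∃ s : Finset H, Orthonormal ℂ ((↑) : s → H) ∧ r = ∑ e ∈ s, ‖L e‖ ^ 2}
  have hbdd : BddAbove S := ⟨τ, by rintro _ ⟨s, hs, rfl⟩; exact hτ s hs⟩
  have hne : S.Nonempty := ⟨0, ∅, ⟨fun i => (Finset.notMem_empty _ i.2).elim,
    fun i => (Finset.notMem_empty _ i.2).elim⟩, by simp⟩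
  -- The sum over `s` is within `ε` of the supremum, so a further unit vector orthogonal to `s` can
  -- add at most `ε`.
  obtain ⟨_, ⟨s, hs, rfl⟩, hlt⟩ := exists_lt_of_lt_csSup hne (sub_lt_self (sSup S) hε)
  refine ⟨s, fun f hf => ?_⟩
  by_cases hf0 : f = 0
  · simp [hf0]
  have hnf : 0 < ‖f‖ := norm_pos_iff.2 hf0
  let g : H := ((‖f‖⁻¹ : ℝ) : ℂ) • f
  have hg1 : ‖g‖ = 1 := by simp [g, norm_smul, hnf.ne']
  have hgs : ∀ e ∈ s, inner ℂ e g = 0 := fun e he => by simp [g, hf e he]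
  have hgs' : ∀ e ∈ s, inner ℂ g e = 0 := fun e he => inner_eq_zero_symm.1 (hgs e he)
  have hgn : g ∉ s := fun h => by
    have := hgs g h
    rw [inner_self_eq_zero] at this
    simp [this] at hg1
  have hs' : Orthonormal ℂ (fun i : {i // i ∈ insert g s} => (i : H)) := by
    have hs := (orthonormal_subtype_iff_ite (s := (s : Set H))).1 hs
    refine (orthonormal_subtype_iff_ite (s := ((insert g s : Finset H) : Set H))).2 ?_
    intro v hv w hw
    rw [Finset.mem_coe, Finset.mem_insert] at hv hw
    rcases hv with rfl | hv <;> rcases hw with rfl | hw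
    · simp [inner_self_eq_norm_sq_to_K, hg1]
    · rw [hgs' w hw, if_neg]
      rintro rfl
      exact hgn hw
    · rw [hgs v hv, if_neg]
      rintro rfl
      exact hgn hv
    · exact hs v hv w hw
  have h1 : ∑ e ∈ insert g s, ‖L e‖ ^ 2 ≤ sSup S := le_csSup hbdd ⟨_, hs', rfl⟩
  rw [Finset.sum_insert hgn] at h1
  have h2 : ‖L g‖ ^ 2 ≤ ε := by linarith
  have h3 : ‖L g‖ = ‖f‖⁻¹ * ‖L f‖ := by simp [g, norm_smul]
  rw [h3, mul_pow, inv_pow, inv_mul_le_iff₀ (by positivity)] at h2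
  linarith

variable [CompleteSpace E]

/-- Composing `L` with the projection onto the span of a suitable finite set gives finite-rank
operators converging to `L` in norm. -/
theorem isCompactOperator_of_sum_norm_apply_sq_le (L : H →L[ℂ] E) {τ : ℝ}
    (hτ : ∀ s : Finset H, Orthonormal ℂ ((↑) : s → H) → ∑ e ∈ s, ‖L e‖ ^ 2 ≤ τ) :
    IsCompactOperator L := by
  have key : ∀ n : ℕ, ∃ A : H →L[ℂ] E, IsCompactOperator A ∧ ‖A - L‖ ≤ 1 / ((n : ℝ) + 1) := by
    intro n
    obtain ⟨s, hs⟩ := exists_finset_norm_apply_sq_le L hτ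
      (ε := (1 / ((n : ℝ) + 1)) ^ 2) (by positivity)
    let V : Submodule ℂ H := Submodule.span ℂ (s : Set H)
    have hfin : FiniteDimensional ℂ V := FiniteDimensional.span_finset ℂ s
    refine ⟨L ∘L V.starProjection, ?_, ?_⟩
    · have := FiniteDimensional.proper ℂ V
      have hP := isCompactOperator_of_locallyCompactSpace_dom V.orthogonalProjectionOnto
      exact hP.clm_comp (L ∘L V.subtypeL)
    · refine opNorm_le_bound _ (by positivity) fun f => ?_
      have h1 : ‖L (f - V.starProjection f)‖ ^ 2
          ≤ (1 / ((n : ℝ) + 1)) ^ 2 * ‖f - V.starProjection f‖ ^ 2 :=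
        hs _ fun e he => (V.mem_orthogonal _).1 (V.sub_starProjection_mem_orthogonal f) e
          (Submodule.subset_span he)
      have h2 : ‖f - V.starProjection f‖ ≤ ‖f‖ := by
        have h := V.norm_sq_eq_add_norm_sq_starProjection f
        rw [V.starProjection_orthogonal_val] at h
        exact le_of_sq_le_sq (by nlinarith [sq_nonneg ‖V.starProjection f‖]) (norm_nonneg _)
      rw [← mul_pow] at h1
      have h3 := le_of_sq_le_sq h1 (by positivity)
      calc ‖(L ∘L V.starProjection - L) f‖ = ‖L (f - V.starProjection f)‖ := by
            rw [map_sub, norm_sub_rev]; rfl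
        _ ≤ _ := h3.trans (by gcongr)
  choose A hA hAL using key
  refine isCompactOperator_of_tendsto (l := atTop) (F := A) ?_ (Eventually.of_forall hA)
  rw [tendsto_iff_norm_sub_tendsto_zero]
  exact squeeze_zero (fun _ => norm_nonneg _) hAL tendsto_one_div_add_atTop_nhds_zero_nat

variable [CompleteSpace H]

/-- A positive compact operator has its norm as an eigenvalue. -/
theorem exists_norm_eq_one_apply_eq_norm_smul {K : H →L[ℂ] H} (hK : K.IsPositive)
    (hc : IsCompactOperator K) (h0 : K ≠ 0) :
    ∃ v : H, ‖v‖ = 1 ∧ K v = (‖K‖ : ℂ) • v := by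
  have hnt : Nontrivial H := by
    by_contra h
    rw [not_nontrivial_iff_subsingleton] at h
    exact h0 (ContinuousLinearMap.ext fun x => Subsingleton.elim _ _)
  -- For a self-adjoint operator the spectral radius is the norm. Compactness makes this nonzero
  -- spectral value an eigenvalue, and positivity fixes its phase.
  obtain ⟨μ, hμ, hμn⟩ := spectrum.exists_nnnorm_eq_spectralRadius K
  rw [hK.isSelfAdjoint.spectralRadius_eq_nnnorm] at hμn
  have hμn : ‖μ‖ = ‖K‖ := by
    have : ‖μ‖₊ = ‖K‖₊ := by exact_mod_cast hμn
    exact congrArg NNReal.toReal this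
  have hμ0 : μ ≠ 0 := by
    rintro rfl
    rw [norm_zero] at hμn
    exact h0 (norm_eq_zero.1 hμn.symm)
  have hev := (hc.hasEigenvalue_iff_mem_spectrum hμ0).2 hμ
  obtain ⟨v, hv⟩ := hev.exists_hasEigenvector
  have hKv : K v = μ • v := hv.apply_eq_smul
  have hv0 : 0 < ‖v‖ := norm_pos_iff.2 hv.2
  have hpos := hK.inner_nonneg_right v
  rw [hKv, inner_smul_right, inner_self_eq_norm_sq_to_K] at hpos
  have hμ' : 0 ≤ μ := by
    have h2 : (0 : ℂ) < (‖v‖ : ℂ) ^ 2 := by exact_mod_cast pow_pos hv0 2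
    exact le_of_mul_le_mul_right (by simpa using hpos) h2
  have hμK : μ = (‖K‖ : ℂ) := by
    rw [← hμn]
    exact (RCLike.norm_of_nonneg' hμ').symm
  refine ⟨((‖v‖⁻¹ : ℝ) : ℂ) • v, by simp [norm_smul, hv0.ne'], ?_⟩
  rw [map_smul, hKv, hμK, smul_comm]

/-- The largest eigenvalue on the orthogonal complement of an invariant subspace is attained. -/
theorem exists_top_eigenvector_orthogonal {K : H →L[ℂ] H} (hK : K.IsPositive)
    (hc : IsCompactOperator K) (W : Submodule ℂ H) (hW : ∀ f ∈ W, K f ∈ W) (hne : Wᗮ ≠ ⊥) :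
    ∃ (v : H) (l : ℝ), v ∈ Wᗮ ∧ ‖v‖ = 1 ∧ K v = (l : ℂ) • v ∧
      ∀ f ∈ Wᗮ, RCLike.re (inner ℂ f (K f)) ≤ l * ‖f‖ ^ 2 := by
  have hWo : ∀ f ∈ Wᗮ, K f ∈ Wᗮ := fun f hf => by
    rw [Submodule.mem_orthogonal] at *
    intro u hu
    rw [← hK.inner_left_eq_inner_right]
    exact hf _ (hW u hu)
  let Q := Wᗮ.starProjection
  have hQf : ∀ f ∈ Wᗮ, Q f = f := fun f hf => Submodule.starProjection_eq_self_iff.2 hf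
  -- The compression to `Wᗮ` is again positive and compact, and agrees with `K` there; its norm is
  -- the eigenvalue sought.
  let A : H →L[ℂ] H := Q ∘L K ∘L Q
  have hA : ∀ f ∈ Wᗮ, A f = K f := fun f hf => by
    change Q (K (Q f)) = K f
    rw [hQf f hf, hQf _ (hWo f hf)]
  have hAp : A.IsPositive := hK.conj_starProjection Wᗮ
  have hAc : IsCompactOperator A := (hc.comp_clm Q).clm_comp Q
  have hv : ∃ v ∈ Wᗮ, ‖v‖ = 1 ∧ K v = (‖A‖ : ℂ) • v := by
    -- If `K` vanishes on `Wᗮ`, any unit vector there serves, with eigenvalue 0. This continues the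
    -- sequence when `K` has finite rank.
    by_cases h0 : A = 0
    · obtain ⟨u, hu, hu0⟩ := Submodule.exists_mem_ne_zero_of_ne_bot hne
      have hu0' : ‖u‖ ≠ 0 := norm_ne_zero_iff.2 hu0
      have hmem : ((‖u‖⁻¹ : ℝ) : ℂ) • u ∈ Wᗮ := Submodule.smul_mem _ _ hu
      refine ⟨_, hmem, by simp [norm_smul, hu0'], ?_⟩
      rw [← hA _ hmem, h0]
      simp
    · obtain ⟨v, hv1, hv⟩ := exists_norm_eq_one_apply_eq_norm_smul hAp hAc h0
      have hn : (‖A‖ : ℂ) ≠ 0 := by exact_mod_cast norm_ne_zero_iff.2 h0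
      have hmem : v ∈ Wᗮ := by
        have : (‖A‖ : ℂ) • v ∈ Wᗮ := hv ▸ Submodule.starProjection_apply_mem _ _
        exact (Submodule.smul_mem_iff _ hn).1 this
      exact ⟨v, hmem, hv1, by rw [← hA v hmem, hv]⟩
  obtain ⟨v, hvW, hv1, hv⟩ := hv
  refine ⟨v, ‖A‖, hvW, hv1, hv, fun f hf => ?_⟩
  rw [← hA f hf]
  calc RCLike.re (inner ℂ f (A f)) ≤ ‖f‖ * ‖A f‖ := re_inner_le_norm _ _
    _ ≤ ‖f‖ * (‖A‖ * ‖f‖) := by gcongr; exact A.le_opNorm f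
    _ = _ := by ring

/-- The operator `L† ∘ L` of a map with bounded `∑ ‖L e‖ ^ 2` has an orthonormal sequence of
eigenvectors with decreasing eigenvalues on whose orthogonal complement it vanishes. -/
theorem exists_antitone_eigensystem (hinf : ¬ FiniteDimensional ℂ H) (L : H →L[ℂ] E) {τ : ℝ}
    (hτ : ∀ s : Finset H, Orthonormal ℂ ((↑) : s → H) → ∑ e ∈ s, ‖L e‖ ^ 2 ≤ τ) :
    ∃ (ψ : ℕ → H) (l : ℕ → ℝ), Orthonormal ℂ ψ ∧ (∀ k, (adjoint L ∘L L) (ψ k) = (l k : ℂ) • ψ k) ∧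
      Antitone l ∧ ∀ f, (∀ k, inner ℂ (ψ k) f = 0) → (adjoint L ∘L L) f = 0 := by
  have hK : (adjoint L ∘L L).IsPositive := isPositive_adjoint_comp_self L
  have hc : IsCompactOperator (adjoint L ∘L L) :=
    (isCompactOperator_of_sum_norm_apply_sq_le L hτ).clm_comp (adjoint L)
  have hKL : ∀ f, RCLike.re (inner ℂ f ((adjoint L ∘L L) f)) = ‖L f‖ ^ 2 := fun f => by
    rw [comp_apply, adjoint_inner_right, inner_self_eq_norm_sq]
  set K := adjoint L ∘L L with hKdef
  -- The states of the greedy construction: finite-dimensional invariant subspaces, each enlarged by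
  -- a top eigenvector of its complement.
  let Good := {W : Submodule ℂ H // FiniteDimensional ℂ W ∧ ∀ f ∈ W, K f ∈ W}
  have step : ∀ W : Good, ∃ p : H × ℝ, p.1 ∈ W.1ᗮ ∧ ‖p.1‖ = 1 ∧ K p.1 = (p.2 : ℂ) • p.1 ∧
      ∀ f ∈ W.1ᗮ, RCLike.re (inner ℂ f (K f)) ≤ p.2 * ‖f‖ ^ 2 := by
    rintro ⟨W, hfin, hW⟩
    have hne : Wᗮ ≠ ⊥ := fun h => hinf <| by
      rw [Submodule.orthogonal_eq_bot_iff] at h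
      subst h
      exact Module.Finite.equiv (Submodule.topEquiv (R := ℂ) (M := H))
    obtain ⟨v, l, h⟩ := exists_top_eigenvector_orthogonal hK hc W hW hne
    exact ⟨(v, l), h⟩
  choose F hF1 hF2 hF3 hF4 using step
  let next : Good → Good := fun W => ⟨W.1 ⊔ Submodule.span ℂ {(F W).1}, by
    have := W.2.1
    infer_instance, by
    intro f hf
    obtain ⟨a, ha, b, hb, rfl⟩ := Submodule.mem_sup.1 hf
    obtain ⟨c, rfl⟩ := Submodule.mem_span_singleton.1 hb
    rw [map_add, map_smul, hF3]
    exact Submodule.add_mem_sup (W.2.2 a ha)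
      (Submodule.smul_mem _ _ (Submodule.smul_mem _ _ (Submodule.mem_span_singleton_self _)))⟩
  let W : ℕ → Good := fun n => next^[n] ⟨⊥, inferInstance, by simp⟩
  have hWs : ∀ n, W (n + 1) = next (W n) := fun n => Function.iterate_succ_apply' _ _ _
  have hWm : Monotone fun n => (W n).1 := monotone_nat_of_le_succ fun n => by
    rw [hWs]; exact le_sup_left
  have hmem : ∀ n, (F (W n)).1 ∈ (W (n + 1)).1 := fun n => by
    rw [hWs]; exact Submodule.mem_sup_right (Submodule.mem_span_singleton_self _)
  have horth : Orthonormal ℂ fun n => (F (W n)).1 := by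
    refine ⟨fun n => hF2 _, fun m n hmn => ?_⟩
    rcases lt_or_gt_of_ne hmn with h | h
    · exact (Submodule.mem_orthogonal _ _).1 (hF1 (W n)) _ (hWm (Nat.succ_le_of_lt h) (hmem m))
    · exact inner_eq_zero_symm.1
        ((Submodule.mem_orthogonal _ _).1 (hF1 (W m)) _ (hWm (Nat.succ_le_of_lt h) (hmem n)))
  have hl : ∀ n, ‖L (F (W n)).1‖ ^ 2 = (F (W n)).2 := fun n => by
    rw [← hKL, hF3, inner_smul_right, inner_self_eq_norm_sq_to_K, hF2]
    simp
  -- The eigenvalues are `‖L (ψ n)‖²`, whose finite sums are at most `τ`; hence they are summable.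
  have hl0 : Tendsto (fun n => (F (W n)).2) atTop (𝓝 0) := by
    refine Summable.tendsto_atTop_zero (summable_of_sum_le (c := τ) (fun n => ?_) fun u => ?_)
    · rw [← hl]; positivity
    · classical
      have hinj := horth.linearIndependent.injective
      have hu := hτ (u.image fun n => (F (W n)).1) (by
        have := horth.toSubtypeRange
        exact this.comp (fun i : (u.image fun n => (F (W n)).1) => ⟨i.1, by
          obtain ⟨n, -, hn⟩ := Finset.mem_image.1 i.2
          exact ⟨n, hn⟩⟩) fun i j h => by
          exact Subtype.ext (Subtype.mk.inj h))
      rw [Finset.sum_image fun a _ b _ h => hinj h] at hu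
      simpa [hl] using hu
  refine ⟨fun n => (F (W n)).1, fun n => (F (W n)).2, horth, fun n => hF3 _,
    antitone_nat_of_succ_le fun n => ?_, fun f hf => ?_⟩
  -- The next eigenvector already competed in the maximization at stage `n`.
  · have h := hF4 (W n) (F (W (n + 1))).1
      (Submodule.orthogonal_le (hWm n.le_succ) (hF1 (W (n + 1))))
    rw [hKL, hl, hF2] at h
    simpa using h
  · have hfW : ∀ n, f ∈ (W n).1ᗮ := by
      intro n
      induction n with
      | zero =>
        change f ∈ (⊥ : Submodule ℂ H)ᗮ
        simp
      | succ n ih =>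
        rw [hWs]
        change f ∈ ((W n).1 ⊔ Submodule.span ℂ {(F (W n)).1})ᗮ
        rw [← Submodule.inf_orthogonal]
        exact ⟨ih, (Submodule.mem_orthogonal_singleton_iff_inner_right).2 (hf n)⟩
    -- `f` lies in every complement, so `‖L f‖²` is at most each eigenvalue times `‖f‖²`; let the
    -- eigenvalues tend to 0.
    have hle : ‖L f‖ ^ 2 ≤ 0 * ‖f‖ ^ 2 :=
      ge_of_tendsto' (hl0.mul_const _) fun n => by
        rw [← hKL]; exact hF4 (W n) f (hfW n)
    have : L f = 0 := by
      rw [zero_mul] at hle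
      exact norm_eq_zero.1 (pow_eq_zero_iff two_ne_zero |>.1 (le_antisymm hle (by positivity)))
    rw [hKdef, comp_apply, this, map_zero]

end Hilbert

/-! ### Ky Fan's bound and minimization of the quadratic error. -/

/-- Weights in `[0, 1]` of total mass at most `N` put against an antitone sequence. -/
theorem tsum_mul_le_sum_range_of_antitone {g p : ℕ → ℝ} (hg : Antitone g) (hg0 : ∀ k, 0 ≤ g k)
    (hp0 : ∀ k, 0 ≤ p k) (hp1 : ∀ k, p k ≤ 1) (hps : Summable p) {N : ℕ} (hpN : ∑' k, p k ≤ N) :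
    ∑' k, g k * p k ≤ ∑ k ∈ Finset.range N, g k := by
  have hgp : Summable fun k => g k * p k :=
    (hps.mul_left (g 0)).of_nonneg_of_le (fun k => mul_nonneg (hg0 k) (hp0 k))
      fun k => mul_le_mul_of_nonneg_right (hg (Nat.zero_le k)) (hp0 k)
  -- Measured from the level `g N`, only the first `N` terms are in excess, and there the weight is
  -- at most 1.
  let d : ℕ → ℝ := fun k => if k ∈ Finset.range N then g k - g N else 0
  have hd : HasSum d (∑ k ∈ Finset.range N, (g k - g N)) := by
    have h : ∑ k ∈ Finset.range N, d k = ∑ k ∈ Finset.range N, (g k - g N) :=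
      Finset.sum_congr rfl fun k hk => if_pos hk
    exact h ▸ hasSum_sum_of_ne_finset_zero fun k hk => if_neg hk
  have hle : ∀ k, g k * p k ≤ g N * p k + d k := fun k => by
    by_cases hk : k < N
    · have h1 : d k = g k - g N := if_pos (Finset.mem_range.2 hk)
      rw [h1]
      nlinarith [hg hk.le, hp1 k]
    · have h1 : d k = 0 := if_neg (by simpa using hk)
      rw [h1, add_zero]
      exact mul_le_mul_of_nonneg_right (hg (not_lt.1 hk)) (hp0 k)
  calc ∑' k, g k * p k ≤ ∑' k, (g N * p k + d k) :=
        hgp.tsum_le_tsum hle ((hps.mul_left _).add hd.summable)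
    _ = g N * ∑' k, p k + ∑ k ∈ Finset.range N, (g k - g N) := by
        rw [(hps.mul_left _).tsum_add hd.summable, tsum_mul_left, hd.tsum_eq]
    _ ≤ g N * N + ∑ k ∈ Finset.range N, (g k - g N) := by gcongr; exact hg0 N
    _ = _ := by rw [Finset.sum_sub_distrib, Finset.sum_const, Finset.card_range]; ring

section Quadratic

open ContinuousLinearMap

variable {H F : Type*} [NormedAddCommGroup H] [InnerProductSpace ℂ H]
  [NormedAddCommGroup F] [InnerProductSpace ℂ F]

/-- The part of the mean-squared error of the estimate with sampling vectors `s` and reconstruction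
vectors `v` that depends on these: `K` is the covariance of the signal, and `Φ` realizes the
covariance of the noisy samples. -/
def excessError {N : ℕ} (K : H →L[ℂ] H) (Φ : H →ₗ[ℂ] F) (s v : Fin N → H) : ℝ :=
  (∑ n, ∑ m, inner ℂ (Φ (s n)) (Φ (s m)) * inner ℂ (v m) (v n)).re
    - 2 * (∑ n, inner ℂ (s n) (K (v n))).re

/-- Parseval's identity on the range of an operator diagonalized by `ψ`. -/
theorem hasSum_norm_apply_sq [CompleteSpace H] {K : H →L[ℂ] H} (hK : K.IsPositive) {ψ : ℕ → H}
    {l : ℕ → ℝ} (hψ : Orthonormal ℂ ψ) (hev : ∀ k, K (ψ k) = (l k : ℂ) • ψ k)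
    (hcomp : ∀ f, (∀ k, inner ℂ (ψ k) f = 0) → K f = 0) (u : H) :
    HasSum (fun k => l k ^ 2 * ‖inner ℂ (ψ k) u‖ ^ 2) (‖K u‖ ^ 2) := by
  -- Vectors added to `ψ` to complete it to a Hilbert basis are killed by `K`, so Parseval's sum
  -- reduces to `ψ`.
  obtain ⟨w, b, hw, hb⟩ := hψ.toSubtypeRange.exists_hilbertBasis_extension
  have h1 : HasSum (fun i : w => ‖inner ℂ (i : H) (K u)‖ ^ 2) (‖K u‖ ^ 2) := by
    have h := (b.hasSum_inner_mul_inner (K u) (K u)).mapL Complex.reCLM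
    simp only [hb] at h
    convert! h using 1
    · ext i
      rw [← inner_conj_symm (K u), Complex.reCLM_apply, RCLike.conj_mul]
      norm_cast
    · rw [Complex.reCLM_apply, inner_self_eq_norm_sq_to_K]
      norm_cast
  have hinj : Function.Injective fun k => (⟨ψ k, hw ⟨k, rfl⟩⟩ : w) := fun i j h =>
    hψ.linearIndependent.injective (Subtype.mk.inj h)
  rw [← hinj.hasSum_iff] at h1
  · convert! h1 using 1
    ext k
    simp only [Function.comp_apply]
    rw [← hK.inner_left_eq_inner_right, hev, inner_smul_left, norm_mul]
    simp [mul_pow]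
  · rintro i hi
    have hKi : K i = 0 := hcomp i fun k => by
      have h := b.orthonormal.2 (i := ⟨ψ k, hw ⟨k, rfl⟩⟩) (j := i) fun h => hi ⟨k, h⟩
      simpa [hb] using h
    simp [← hK.inner_left_eq_inner_right, hKi]

variable {K : H →L[ℂ] H} {Φ : H →ₗ[ℂ] F} {σ : ℝ}

theorem norm_map_sq_eq
    (hΦ : ∀ f g, inner ℂ (Φ f) (Φ g) = inner ℂ f (K g) + (σ : ℂ) ^ 2 * inner ℂ f g) (f : H) :
    ‖Φ f‖ ^ 2 = (inner ℂ f (K f)).re + σ ^ 2 * ‖f‖ ^ 2 := by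
  have h := congrArg Complex.re (hΦ f f)
  rw [← Complex.ofReal_pow, Complex.add_re, Complex.re_ofReal_mul] at h
  have h1 : (inner ℂ (Φ f) (Φ f)).re = ‖Φ f‖ ^ 2 := inner_self_eq_norm_sq (𝕜 := ℂ) _
  have h2 : (inner ℂ f f).re = ‖f‖ ^ 2 := inner_self_eq_norm_sq (𝕜 := ℂ) _
  rwa [h1, h2] at h

theorem eigenvalue_nonneg (hK : K.IsPositive) {ψ : ℕ → H}
    {l : ℕ → ℝ} (hψ : Orthonormal ℂ ψ) (hev : ∀ k, K (ψ k) = (l k : ℂ) • ψ k) (k : ℕ) :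
    0 ≤ l k := by
  have h := hK.re_inner_nonneg_right (ψ k)
  rw [hev, inner_smul_right, inner_self_eq_norm_sq_to_K, hψ.1 k] at h
  simpa using h

/-- Ky Fan's inequality for the generalized eigenvalue problem `K u = μ (K + σ²) u`. -/
theorem sum_norm_apply_sq_le [CompleteSpace H] (hK : K.IsPositive) (hσ : 0 < σ)
    (hΦ : ∀ f g, inner ℂ (Φ f) (Φ g) = inner ℂ f (K g) + (σ : ℂ) ^ 2 * inner ℂ f g) {ψ : ℕ → H}
    {l : ℕ → ℝ} (hψ : Orthonormal ℂ ψ) (hev : ∀ k, K (ψ k) = (l k : ℂ) • ψ k)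
    (hl : Antitone l) (hcomp : ∀ f, (∀ k, inner ℂ (ψ k) f = 0) → K f = 0)
    {r N : ℕ} (hr : r ≤ N) (u : Fin r → H) (hu : Orthonormal ℂ fun j => Φ (u j)) :
    ∑ j, ‖K (u j)‖ ^ 2 ≤ ∑ k ∈ Finset.range N, l k ^ 2 / (l k + σ ^ 2) := by
  have hl0 := eigenvalue_nonneg hK hψ hev
  have hc0 : ∀ k, 0 < l k + σ ^ 2 := fun k => by have := hl0 k; positivity
  -- The `ψ k` are orthogonal for the form `K + σ²` as well, with squared length `l k + σ²`; `β`
  -- normalizes them.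
  let β : ℕ → F := fun k => (((√(l k + σ ^ 2))⁻¹ : ℝ) : ℂ) • Φ (ψ k)
  have hβu : ∀ k f, inner ℂ (β k) (Φ f) = ((√(l k + σ ^ 2) : ℝ) : ℂ) * inner ℂ (ψ k) f := by
    intro k f
    have h1 : ((√(l k + σ ^ 2) : ℝ) : ℂ) ≠ 0 := by exact_mod_cast (Real.sqrt_pos.2 (hc0 k)).ne'
    have h2 : ((√(l k + σ ^ 2) : ℝ) : ℂ) ^ 2 = l k + (σ : ℂ) ^ 2 := by
      exact_mod_cast Real.sq_sqrt (hc0 k).le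
    simp only [β]
    rw [inner_smul_left, hΦ, ← hK.inner_left_eq_inner_right, hev, inner_smul_left,
      Complex.conj_ofReal, Complex.conj_ofReal, ← add_mul, ← h2, Complex.ofReal_inv]
    field_simp
  have hβ : Orthonormal ℂ β := by
    rw [orthonormal_iff_ite]
    intro i j
    have h1 : ((√(l j + σ ^ 2) : ℝ) : ℂ) ≠ 0 := by exact_mod_cast (Real.sqrt_pos.2 (hc0 j)).ne'
    rw [show β j = (((√(l j + σ ^ 2))⁻¹ : ℝ) : ℂ) • Φ (ψ j) from rfl, inner_smul_right, hβu,
      orthonormal_iff_ite.1 hψ]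
    split_ifs with h
    · subst h
      rw [Complex.ofReal_inv]
      field_simp
    · simp
  -- Bessel for `β` bounds the total mass by `r`; Bessel for the `Φ (u j)` bounds each weight by 1.
  let p : ℕ → ℝ := fun k => ∑ j, ‖inner ℂ (β k) (Φ (u j))‖ ^ 2
  have hsum : ∀ j, Summable fun k => ‖inner ℂ (β k) (Φ (u j))‖ ^ 2 := fun j =>
    hβ.inner_products_summable (Φ (u j))
  have hps : Summable p := summable_sum fun j _ => hsum j
  have hpN : ∑' k, p k ≤ N := by
    rw [Summable.tsum_finsetSum fun j _ => hsum j]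
    calc ∑ j, ∑' k, ‖inner ℂ (β k) (Φ (u j))‖ ^ 2 ≤ ∑ j : Fin r, (1 : ℝ) :=
          Finset.sum_le_sum fun j _ => by
            have h := hβ.tsum_inner_products_le (x := Φ (u j))
            rwa [hu.1 j, one_pow] at h
      _ = r := by simp
      _ ≤ N := by exact_mod_cast hr
  have hp1 : ∀ k, p k ≤ 1 := fun k => by
    have h := hu.sum_inner_products_le (x := β k) (s := Finset.univ)
    rw [hβ.1 k, one_pow] at h
    refine le_trans (le_of_eq (Finset.sum_congr rfl fun j _ => ?_)) h
    rw [norm_inner_symm]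
  have hg : Antitone fun k => l k ^ 2 / (l k + σ ^ 2) := by
    intro i j hij
    have h1 := hl hij
    have h2 := hl0 j
    have h3 := hl0 i
    change l j ^ 2 / (l j + σ ^ 2) ≤ l i ^ 2 / (l i + σ ^ 2)
    rw [div_le_div_iff₀ (hc0 j) (hc0 i)]
    -- The difference is `(l i - l j) * (l i * l j + σ² * (l i + l j))`.
    nlinarith [mul_nonneg (mul_nonneg h2 h3) (sub_nonneg.2 h1),
      mul_nonneg (sq_nonneg σ) (mul_nonneg (sub_nonneg.2 h1) (add_nonneg h2 h3))]
  have hKu : HasSum (fun k => l k ^ 2 / (l k + σ ^ 2) * p k) (∑ j, ‖K (u j)‖ ^ 2) := by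
    have h := hasSum_sum (s := Finset.univ) fun j _ => hasSum_norm_apply_sq hK hψ hev hcomp (u j)
    convert! h using 1
    ext k
    simp only [p]
    rw [Finset.mul_sum]
    refine Finset.sum_congr rfl fun j _ => ?_
    rw [hβu, norm_mul, mul_pow, Complex.norm_real, Real.norm_eq_abs, sq_abs,
      Real.sq_sqrt (hc0 k).le]
    have := (hc0 k).ne'
    field_simp
  rw [← hKu.tsum_eq]
  exact tsum_mul_le_sum_range_of_antitone hg (fun k => div_nonneg (sq_nonneg _) (hc0 k).le)
    (fun k => Finset.sum_nonneg fun _ _ => by positivity) hp1 hps hpN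

/-- Lower bound for the error by completing the square in a basis of the sampling space that is
orthonormal with respect to the covariance of the samples. -/
theorem neg_sum_le_excessError [CompleteSpace H] (hK : K.IsPositive) (hσ : 0 < σ)
    (hΦ : ∀ f g, inner ℂ (Φ f) (Φ g) = inner ℂ f (K g) + (σ : ℂ) ^ 2 * inner ℂ f g) {ψ : ℕ → H}
    {l : ℕ → ℝ} (hψ : Orthonormal ℂ ψ) (hev : ∀ k, K (ψ k) = (l k : ℂ) • ψ k)
    (hl : Antitone l) (hcomp : ∀ f, (∀ k, inner ℂ (ψ k) f = 0) → K f = 0)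
    {N : ℕ} (s v : Fin N → H) :
    -∑ k ∈ Finset.range N, l k ^ 2 / (l k + σ ^ 2) ≤ excessError K Φ s v := by
  -- Positive noise makes the form definite, so expansions of `Φ (s n)` pull back to `s n`.
  have hinj : Function.Injective Φ := by
    rw [injective_iff_map_eq_zero]
    intro f hf
    have h := norm_map_sq_eq hΦ f
    have h2 : 0 ≤ (inner ℂ f (K f)).re := hK.re_inner_nonneg_right f
    rw [hf, norm_zero] at h
    have h3 : σ ^ 2 * ‖f‖ ^ 2 ≤ 0 := by nlinarith
    have h4 : ‖f‖ ^ 2 ≤ 0 := nonpos_of_mul_nonpos_right h3 (by positivity)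
    exact norm_eq_zero.1 (pow_eq_zero_iff two_ne_zero |>.1 (le_antisymm h4 (by positivity)))
  let W : Submodule ℂ F := Submodule.span ℂ (range (Φ ∘ s))
  have hfin : FiniteDimensional ℂ W := FiniteDimensional.span_of_finite ℂ (finite_range _)
  let b := stdOrthonormalBasis ℂ W
  have hr : Module.finrank ℂ W ≤ N := by
    have h := finrank_range_le_card (R := ℂ) (Φ ∘ s)
    simpa [Set.finrank] using h
  have hbmem : ∀ j, ∃ u, Φ u = b j := fun j => by
    have h : (b j : F) ∈ (Submodule.span ℂ (range s)).map Φ := by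
      rw [Submodule.map_span, ← range_comp]
      exact (b j).2
    obtain ⟨u, -, hu⟩ := h
    exact ⟨u, hu⟩
  choose u hu using hbmem
  have huo : Orthonormal ℂ fun j => Φ (u j) := by
    simp only [hu]
    exact b.orthonormal.comp_linearIsometry W.subtypeₗᵢ
  have hsW : ∀ n, Φ (s n) ∈ W := fun n => Submodule.subset_span ⟨n, rfl⟩
  let a : Fin N → Fin (Module.finrank ℂ W) → ℂ := fun n j => b.repr ⟨Φ (s n), hsW n⟩ j
  have hs : ∀ n, s n = ∑ j, a n j • u j := fun n => hinj <| by
    have h := congrArg (Subtype.val) (b.sum_repr ⟨Φ (s n), hsW n⟩)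
    rw [map_sum]
    simp only [map_smul, hu]
    exact h.symm.trans (by simp [a])
  -- Samples are conjugate linear in the sampling vector, so these coefficients leave the estimate
  -- formally unchanged.
  let v' : Fin (Module.finrank ℂ W) → H := fun j => ∑ n, conj (a n j) • v n
  have h1 : ∑ n, inner ℂ (s n) (K (v n)) = ∑ j, inner ℂ (K (u j)) (v' j) := by
    simp only [v', inner_sum, inner_smul_right]
    rw [Finset.sum_comm]
    refine Finset.sum_congr rfl fun n _ => ?_
    nth_rw 1 [hs n]
    rw [sum_inner]
    refine Finset.sum_congr rfl fun j _ => ?_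
    rw [inner_smul_left, hK.inner_left_eq_inner_right]
  have h2 : ∑ n, ∑ m, inner ℂ (Φ (s n)) (Φ (s m)) * inner ℂ (v m) (v n)
      = ∑ j, inner ℂ (v' j) (v' j) := by
    have e1 : ∀ n m, inner ℂ (Φ (s n)) (Φ (s m)) = ∑ j, conj (a n j) * a m j := by
      intro n m
      nth_rw 1 [hs n]
      nth_rw 1 [hs m]
      simp only [map_sum, map_smul]
      rw [huo.inner_sum]
    have e2 : ∀ j, inner ℂ (v' j) (v' j)
        = ∑ n, ∑ m, conj (a n j) * a m j * inner ℂ (v m) (v n) := by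
      intro j
      simp only [v', inner_sum, sum_inner, inner_smul_left, inner_smul_right, Complex.conj_conj,
        Finset.mul_sum]
      refine Finset.sum_congr rfl fun n _ => ?_
      refine Finset.sum_congr rfl fun m _ => ?_
      ring
    simp only [e1, e2, Finset.sum_mul]
    rw [Finset.sum_congr rfl fun n _ => Finset.sum_comm, Finset.sum_comm]
  have h3 := sum_norm_apply_sq_le hK hσ hΦ hψ hev hl hcomp hr u huo
  rw [excessError, h1, h2, Complex.re_sum, Complex.re_sum, Finset.mul_sum,
    ← Finset.sum_sub_distrib]
  refine (neg_le_neg h3).trans ?_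
  rw [← Finset.sum_neg_distrib]
  refine Finset.sum_le_sum fun j _ => ?_
  have h4 : (inner ℂ (K (u j)) (v' j)).re ≤ ‖K (u j)‖ * ‖v' j‖ := re_inner_le_norm (𝕜 := ℂ) _ _
  have h5 : (inner ℂ (v' j) (v' j)).re = ‖v' j‖ ^ 2 := inner_self_eq_norm_sq (𝕜 := ℂ) _
  rw [h5]
  nlinarith [sq_nonneg (‖K (u j)‖ - ‖v' j‖)]

/-- The chosen `s n` are orthonormal for `K + σ²` and `v n = K (s n)`, so every completed square
vanishes. -/
theorem excessError_optimal (hK : K.IsPositive) (hσ : 0 < σ)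
    (hΦ : ∀ f g, inner ℂ (Φ f) (Φ g) = inner ℂ f (K g) + (σ : ℂ) ^ 2 * inner ℂ f g) {ψ : ℕ → H}
    {l : ℕ → ℝ} (hψ : Orthonormal ℂ ψ) (hev : ∀ k, K (ψ k) = (l k : ℂ) • ψ k) (N : ℕ) :
    excessError K Φ (fun n : Fin N => ((1 / √(l n + σ ^ 2) : ℝ) : ℂ) • ψ n)
      (fun n : Fin N => ((l n / √(l n + σ ^ 2) : ℝ) : ℂ) • ψ n)
      = -∑ k ∈ Finset.range N, l k ^ 2 / (l k + σ ^ 2) := by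
  have hl0 := eigenvalue_nonneg hK hψ hev
  have hc0 : ∀ k, 0 < l k + σ ^ 2 := fun k => by have := hl0 k; positivity
  have hψi := orthonormal_iff_ite.1 hψ
  have hsq : ∀ k, √(l k + σ ^ 2) * √(l k + σ ^ 2) = l k + σ ^ 2 := fun k =>
    Real.mul_self_sqrt (hc0 k).le
  have hdiv : ∀ k, l k ^ 2 / (l k + σ ^ 2) = l k ^ 2 / (√(l k + σ ^ 2) * √(l k + σ ^ 2)) :=
    fun k => by rw [hsq]
  have h1 : ∀ n : ℕ, inner ℂ (((1 / √(l n + σ ^ 2) : ℝ) : ℂ) • ψ n)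
      (K (((l n / √(l n + σ ^ 2) : ℝ) : ℂ) • ψ n)) = ((l n ^ 2 / (l n + σ ^ 2) : ℝ) : ℂ) := by
    intro n
    rw [map_smul, hev, inner_smul_left, inner_smul_right, inner_smul_right, hψi, if_pos rfl,
      Complex.conj_ofReal, mul_one, ← Complex.ofReal_mul, ← Complex.ofReal_mul, hdiv]
    congr 1
    ring
  have h2 : ∀ n m : ℕ, inner ℂ (Φ (((1 / √(l n + σ ^ 2) : ℝ) : ℂ) • ψ n))
      (Φ (((1 / √(l m + σ ^ 2) : ℝ) : ℂ) • ψ m)) *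
      inner ℂ (((l m / √(l m + σ ^ 2) : ℝ) : ℂ) • ψ m) (((l n / √(l n + σ ^ 2) : ℝ) : ℂ) • ψ n)
      = if n = m then ((l n ^ 2 / (l n + σ ^ 2) : ℝ) : ℂ) else 0 := by
    intro n m
    rw [map_smul, map_smul, inner_smul_left, inner_smul_right, inner_smul_left, inner_smul_right,
      hΦ, hev, inner_smul_right, hψi, hψi]
    by_cases h : n = m
    · subst h
      have hr : √(l n + σ ^ 2) ≠ 0 := (Real.sqrt_pos.2 (hc0 n)).ne'
      simp only [if_true, Complex.conj_ofReal, mul_one, hdiv]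
      norm_cast
      have h2 := hsq n
      generalize √(l n + σ ^ 2) = r at *
      rw [← h2]
      field_simp
    · simp [h]
  have h3 : ∑ n : Fin N, ((l n ^ 2 / (l n + σ ^ 2) : ℝ) : ℂ)
      = ((∑ k ∈ Finset.range N, l k ^ 2 / (l k + σ ^ 2) : ℝ) : ℂ) := by
    rw [Finset.sum_range, Complex.ofReal_sum]
  unfold excessError
  simp only [h1, h2, Fin.val_inj, Finset.sum_ite_eq, Finset.mem_univ, if_true]
  rw [h3, Complex.ofReal_re]
  ring

end Quadratic

/-! ### Inner products and norms in `L²`. -/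

section Lp

variable {α : Type*} [MeasurableSpace α] {μ : Measure α}

theorem integrable_mul_conj {f g : α → ℂ} (hf : MemLp f 2 μ) (hg : MemLp g 2 μ) :
    Integrable (fun a => f a * conj (g a)) μ :=
  hf.integrable_mul hg.star

theorem inner_toLp_right {f : α → ℂ} (hf : MemLp f 2 μ) (g : Lp ℂ 2 μ) :
    inner ℂ g (hf.toLp f) = ∫ a, f a * conj (g a) ∂μ := by
  rw [L2.inner_def]
  refine integral_congr_ae ?_
  filter_upwards [hf.coeFn_toLp] with a ha
  rw [ha, RCLike.inner_apply]

theorem inner_toLp_toLp {f g : α → ℂ} (hf : MemLp f 2 μ) (hg : MemLp g 2 μ) :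
    inner ℂ (hf.toLp f) (hg.toLp g) = ∫ a, g a * conj (f a) ∂μ := by
  rw [inner_toLp_right]
  refine integral_congr_ae ?_
  filter_upwards [hf.coeFn_toLp] with a ha
  rw [ha]

theorem norm_toLp_sq {f : α → ℂ} (hf : MemLp f 2 μ) :
    ‖hf.toLp f‖ ^ 2 = ∫ a, ‖f a‖ ^ 2 ∂μ := by
  have h := inner_self_eq_norm_sq_to_K (𝕜 := ℂ) (hf.toLp f)
  rw [inner_toLp_toLp] at h
  have h2 : ∀ a, f a * conj (f a) = ((‖f a‖ ^ 2 : ℝ) : ℂ) := fun a => by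
    rw [RCLike.mul_conj]; norm_cast
  simp only [h2] at h
  rw [integral_complex_ofReal] at h
  exact Complex.ofReal_injective (by push_cast; exact h.symm)

theorem lintegral_enorm_sq_eq (f : Lp ℂ 2 μ) :
    ∫⁻ a, ‖f a‖ₑ ^ 2 ∂μ = ENNReal.ofReal (‖f‖ ^ 2) := by
  have h : ENNReal.ofReal ‖f‖ = eLpNorm f 2 μ := by
    rw [Lp.norm_def, ENNReal.ofReal_toReal (Lp.eLpNorm_ne_top f)]
  have h2 := eLpNorm_nnreal_pow_eq_lintegral (μ := μ) (f := (f : α → ℂ)) (p := 2) two_ne_zero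
  rw [ENNReal.ofReal_pow (norm_nonneg _), h]
  have h3 : eLpNorm f ((2 : NNReal) : ℝ≥0∞) μ = eLpNorm f 2 μ := by norm_num
  rw [h3] at h2
  simpa using h2.symm

/-- Indicators of infinitely many disjoint intervals are orthogonal and nonzero. Infinite dimension
is needed for an eigensystem indexed by all of `ℕ`. -/
theorem not_finiteDimensional_signalSpace {T : ℝ} (hT : 0 < T) :
    ¬ FiniteDimensional ℂ (SignalSpace T) := by
  intro hfin
  let I : ℕ → Set ℝ := fun n => Ioc (T / (n + 2)) (T / (n + 1))
  have hI : ∀ n, MeasurableSet (I n) := fun n => measurableSet_Ioc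
  have hlt : ∀ n : ℕ, T / ((n : ℝ) + 2) < T / (n + 1) := fun n =>
    div_lt_div_of_pos_left hT (by positivity) (by linarith)
  have hdisj : ∀ m n : ℕ, m < n → I m ∩ I n = ∅ := fun m n h => by
    have h1 : (m : ℝ) + 1 ≤ n := by exact_mod_cast h
    have h2 : T / ((n : ℝ) + 1) ≤ T / (m + 2) :=
      div_le_div_of_nonneg_left hT.le (by positivity) (by linarith)
    ext t
    simp only [I, mem_inter_iff, mem_Ioc, mem_empty_iff_false, iff_false]
    rintro ⟨⟨h3, -⟩, -, h4⟩
    linarith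
  have hsub : ∀ n, I n ⊆ Icc 0 T := fun n t ht =>
    ⟨(lt_of_le_of_lt (by positivity) ht.1).le,
      ht.2.trans (div_le_self hT.le (by simp))⟩
  let v : ℕ → SignalSpace T := fun n =>
    indicatorConstLp 2 (hI n) (measure_ne_top (timeMeasure T) _) (1 : ℂ)
  have hv : LinearIndependent ℂ v := by
    refine linearIndependent_of_ne_zero_of_inner_eq_zero (fun n h => ?_) fun m n hmn => ?_
    · have h1 := L2.inner_indicatorConstLp_indicatorConstLp (𝕜 := ℂ) (hI n) (hI n)
        (measure_ne_top (timeMeasure T) _) (measure_ne_top (timeMeasure T) _) (1 : ℂ) (1 : ℂ)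
      change inner ℂ (v n) (v n) = _ at h1
      rw [h, inner_zero_left, inter_self, Measure.real, Measure.restrict_apply (hI n),
        inter_eq_self_of_subset_left (hsub n), Real.volume_Ioc,
        ENNReal.toReal_ofReal (sub_nonneg.2 (hlt n).le)] at h1
      have h2 := hlt n
      have h3 : T / ((n : ℝ) + 1) - T / (n + 2) = 0 := by
        rw [inner_self_eq_norm_sq_to_K, norm_one, Complex.real_smul] at h1
        exact_mod_cast (by simpa only [RCLike.ofReal_one, one_pow, mul_one] using h1.symm :
          ((T / ((n : ℝ) + 1) - T / (n + 2) : ℝ) : ℂ) = 0)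
      linarith
    · have h1 := L2.inner_indicatorConstLp_indicatorConstLp (𝕜 := ℂ) (hI m) (hI n)
        (measure_ne_top (timeMeasure T) _) (measure_ne_top (timeMeasure T) _) (1 : ℂ) (1 : ℂ)
      have h2 : I m ∩ I n = ∅ := by
        rcases lt_or_gt_of_ne hmn with h | h
        · exact hdisj m n h
        · rw [inter_comm]; exact hdisj n m h
      rw [h2] at h1
      simpa using h1
  exact Module.Finite.not_linearIndependent_of_infinite v hv

end Lp

/-! ### Sample paths and the covariance operator. -/

section Covariance

variable {Ω : Type*} [MeasurableSpace Ω] {P : Measure Ω} {T : ℝ} {x : ℝ → Ω → ℂ}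

theorem conj_autocorrelation (P : Measure Ω) (x : ℝ → Ω → ℂ) (t η : ℝ) :
    conj (autocorrelation P x t η) = autocorrelation P x η t := by
  rw [autocorrelation, autocorrelation, ← integral_conj]
  exact integral_congr_ae (.of_forall fun ω => by simp [mul_comm])

theorem ae_timeMeasure_mem (T : ℝ) : ∀ᵐ t ∂(timeMeasure T), t ∈ Icc 0 T :=
  ae_restrict_mem measurableSet_Icc

/-- The kernel is bounded on the compact square, so the integral is a bounded function on a finite
measure space. -/
theorem memLp_integral_autocorrelation (hx : IsContinuousCovarianceProcess P T x)
    (g : SignalSpace T) :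
    MemLp (fun t => ∫ η, autocorrelation P x t η * g η ∂(timeMeasure T)) 2 (timeMeasure T) := by
  have hc := hx.continuousOn_autocorrelation
  obtain ⟨M, hM⟩ := (isCompact_Icc.prod isCompact_Icc).exists_bound_of_continuousOn hc
  have hR : AEStronglyMeasurable (fun p : ℝ × ℝ => autocorrelation P x p.1 p.2)
      ((timeMeasure T).prod (timeMeasure T)) := by
    rw [Measure.prod_restrict]
    exact hc.aestronglyMeasurable (measurableSet_Icc.prod measurableSet_Icc)
  have hm := (hR.mul (Lp.aestronglyMeasurable g).comp_snd).integral_prod_right'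
  refine MemLp.of_bound hm (∫ η, M * ‖g η‖ ∂(timeMeasure T)) ?_
  have hg : Integrable g (timeMeasure T) := (Lp.memLp g).integrable one_le_two
  filter_upwards [ae_timeMeasure_mem T] with t ht
  refine norm_integral_le_of_norm_le (hg.norm.const_mul M) ?_
  filter_upwards [ae_timeMeasure_mem T] with η hη
  change ‖autocorrelation P x t η * g η‖ ≤ _
  rw [norm_mul]
  exact mul_le_mul_of_nonneg_right (hM (t, η) ⟨ht, hη⟩) (norm_nonneg _)

variable [IsProbabilityMeasure P]

/-- `E|x(t)|²` is the diagonal of the autocorrelation, which is continuous and hence integrable over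
`[0, T]`. -/
theorem IsContinuousCovarianceProcess.memLp_prod (hx : IsContinuousCovarianceProcess P T x) :
    MemLp (fun p : ℝ × Ω => x p.1 p.2) 2 ((timeMeasure T).prod P) := by
  have hm := hx.aestronglyMeasurable
  refine (memLp_two_iff_integrable_sq_norm hm).2 ((integrable_prod_iff (hm.norm.pow 2)).2 ?_)
  constructor
  · filter_upwards [ae_timeMeasure_mem T] with t ht
    exact (hx.memLp t ht).norm.integrable_sq
  · have hc : ContinuousOn (fun t => (autocorrelation P x t t).re) (Icc 0 T) :=
      Complex.continuous_re.comp_continuousOn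
        (hx.continuousOn_autocorrelation.comp (f := fun t => (t, t)) (by fun_prop)
          fun t ht => ⟨ht, ht⟩)
    refine Integrable.congr (hc.integrableOn_compact isCompact_Icc) (.of_forall fun t => ?_)
    change (∫ ω, x t ω * conj (x t ω) ∂P).re = ∫ ω, ‖‖x t ω‖ ^ 2‖ ∂P
    have h2 : ∀ ω, x t ω * conj (x t ω) = ((‖‖x t ω‖ ^ 2‖ : ℝ) : ℂ) := fun ω => by
      rw [RCLike.mul_conj, norm_pow, norm_norm]; norm_cast
    simp only [h2]
    rw [integral_complex_ofReal, Complex.ofReal_re]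

/-- Almost every path is a signal. -/
theorem IsContinuousCovarianceProcess.ae_memLp_path (hx : IsContinuousCovarianceProcess P T x) :
    ∀ᵐ ω ∂P, MemLp (fun t => x t ω) 2 (timeMeasure T) := by
  have hm := hx.aestronglyMeasurable
  have hi := (memLp_two_iff_integrable_sq_norm hm).1 hx.memLp_prod
  filter_upwards [hm.prod_swap.prodMk_left, hi.swap.prod_right_ae] with ω h1 h2
  exact (memLp_two_iff_integrable_sq_norm h1).2 h2

/-- The energy `∫ |x(t)|² dt` of a path. -/
def pathEnergy (T : ℝ) (x : ℝ → Ω → ℂ) (ω : Ω) : ℝ := ∫ t, ‖x t ω‖ ^ 2 ∂(timeMeasure T)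

/-- The noiseless sample `⟨x, f⟩`. -/
def signalSample (x : ℝ → Ω → ℂ) (f : SignalSpace T) (ω : Ω) : ℂ :=
  ∫ t, x t ω * conj (f t) ∂(timeMeasure T)

theorem IsContinuousCovarianceProcess.integrable_pathEnergy
    (hx : IsContinuousCovarianceProcess P T x) : Integrable (pathEnergy T x) P :=
  ((memLp_two_iff_integrable_sq_norm hx.aestronglyMeasurable).1 hx.memLp_prod).integral_prod_right

/-- This lets pathwise statements be proved as Hilbert space identities for the single vector `X`.
-/
theorem IsContinuousCovarianceProcess.ae_exists_path (hx : IsContinuousCovarianceProcess P T x) :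
    ∀ᵐ ω ∂P, ∃ X : SignalSpace T, (X =ᵐ[timeMeasure T] fun t => x t ω) ∧
      (∀ f : SignalSpace T, signalSample x f ω = inner ℂ f X) ∧ pathEnergy T x ω = ‖X‖ ^ 2 := by
  filter_upwards [hx.ae_memLp_path] with ω h
  exact ⟨h.toLp _, h.coeFn_toLp, fun f => (inner_toLp_right h f).symm, (norm_toLp_sq h).symm⟩

theorem IsContinuousCovarianceProcess.memLp_signalSample
    (hx : IsContinuousCovarianceProcess P T x) (f : SignalSpace T) :
    MemLp (signalSample x f) 2 P := by
  have hf : AEStronglyMeasurable (fun p : Ω × ℝ => conj (f p.2)) (P.prod (timeMeasure T)) :=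
    ((Lp.aestronglyMeasurable f).comp_snd).star
  have hm : AEStronglyMeasurable (signalSample x f) P :=
    (hx.aestronglyMeasurable.prod_swap.mul hf).integral_prod_right'
  rw [memLp_two_iff_integrable_sq_norm hm]
  refine (hx.integrable_pathEnergy.const_mul (‖f‖ ^ 2)).mono' (hm.norm.pow 2) ?_
  filter_upwards [hx.ae_exists_path] with ω ⟨X, _, hX, hE⟩
  rw [hX, hE, norm_pow, norm_norm, ← mul_pow]
  exact pow_le_pow_left₀ (norm_nonneg _) (norm_inner_le_norm f X) 2

/-- The map `f ↦ ⟨x, f⟩*` into the square-integrable random variables. -/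
def sampleOperator (hx : IsContinuousCovarianceProcess P T x) : SignalSpace T →L[ℂ] Lp ℂ 2 P :=
  LinearMap.mkContinuous
    { toFun := fun f => (hx.memLp_signalSample f).star.toLp _
      map_add' := fun f g => by
        rw [← MemLp.toLp_add, MemLp.toLp_eq_toLp_iff]
        filter_upwards [hx.ae_exists_path] with ω ⟨X, _, hX, _⟩
        simp [hX, inner_add_left]
      map_smul' := fun c f => by
        rw [RingHom.id_apply, ← MemLp.toLp_const_smul, MemLp.toLp_eq_toLp_iff]
        filter_upwards [hx.ae_exists_path] with ω ⟨X, _, hX, _⟩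
        simp [hX, inner_smul_left] }
    (√(∫ ω, pathEnergy T x ω ∂P)) fun f => by
      change ‖(hx.memLp_signalSample f).star.toLp _‖ ≤ _
      refine le_of_sq_le_sq ?_ (by positivity)
      rw [norm_toLp_sq, mul_pow, Real.sq_sqrt, ← integral_mul_const]
      · refine integral_mono_ae (hx.memLp_signalSample f).star.norm.integrable_sq
          (hx.integrable_pathEnergy.mul_const _) ?_
        filter_upwards [hx.ae_exists_path] with ω ⟨X, _, hX, hE⟩
        simp only [Pi.star_apply, norm_star]
        rw [hX, hE, ← mul_pow, mul_comm]
        exact pow_le_pow_left₀ (norm_nonneg _) (norm_inner_le_norm f X) 2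
      · exact integral_nonneg fun ω => integral_nonneg fun t => by positivity

theorem inner_sampleOperator (hx : IsContinuousCovarianceProcess P T x) (f g : SignalSpace T) :
    inner ℂ (sampleOperator hx f) (sampleOperator hx g)
      = ∫ ω, signalSample x f ω * conj (signalSample x g ω) ∂P := by
  change inner ℂ ((hx.memLp_signalSample f).star.toLp _)
    ((hx.memLp_signalSample g).star.toLp _) = _
  rw [inner_toLp_toLp]
  refine integral_congr_ae (.of_forall fun ω => ?_)
  simp [mul_comm]

/-- Bessel's inequality for each path, averaged over paths. -/
theorem sum_norm_sampleOperator_sq_le (hx : IsContinuousCovarianceProcess P T x)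
    (s : Finset (SignalSpace T)) (hs : Orthonormal ℂ ((↑) : s → SignalSpace T)) :
    ∑ e ∈ s, ‖sampleOperator hx e‖ ^ 2 ≤ ∫ ω, pathEnergy T x ω ∂P := by
  have h : ∀ e, ‖sampleOperator hx e‖ ^ 2 = ∫ ω, ‖signalSample x e ω‖ ^ 2 ∂P := fun e => by
    change ‖(hx.memLp_signalSample e).star.toLp _‖ ^ 2 = _
    rw [norm_toLp_sq]
    simp
  simp only [h]
  rw [← integral_finsetSum _ fun e _ => (hx.memLp_signalSample e).norm.integrable_sq]
  refine integral_mono_ae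
    (integrable_finsetSum _ fun e _ => (hx.memLp_signalSample e).norm.integrable_sq)
    hx.integrable_pathEnergy ?_
  filter_upwards [hx.ae_exists_path] with ω ⟨X, _, hX, hE⟩
  rw [hE]
  simp only [hX]
  rw [← Finset.sum_coe_sort]
  exact hs.sum_inner_products_le (x := X) (s := Finset.univ)

/-- Correlations of samples are obtained from those of the signal. -/
theorem integral_signalSample_mul_conj (hx : IsContinuousCovarianceProcess P T x)
    (f : SignalSpace T) {Y : Ω → ℂ} (hY : MemLp Y 2 P) :
    ∫ ω, signalSample x f ω * conj (Y ω) ∂P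
      = ∫ t, (∫ ω, x t ω * conj (Y ω) ∂P) * conj (f t) ∂(timeMeasure T) := by
  -- Fubini applies because `x` and `f ⊗ Y` are both square-integrable on the product.
  have hfY : MemLp (fun p : ℝ × Ω => f p.1 * Y p.2) 2 ((timeMeasure T).prod P) := by
    refine (memLp_two_iff_integrable_sq_norm
      ((Lp.aestronglyMeasurable f).comp_fst.mul hY.1.comp_snd)).2 ?_
    have h := (Lp.memLp f).norm.integrable_sq.mul_prod hY.norm.integrable_sq
    refine h.congr (.of_forall fun p => ?_)
    simp [mul_pow]
  have hi := integrable_mul_conj hx.memLp_prod hfY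
  have hswap := integral_integral_swap
    (f := fun t ω => x t ω * conj (f t * Y ω)) (μ := timeMeasure T) (ν := P) hi
  simp only [signalSample]
  calc _ = ∫ ω, ∫ t, x t ω * conj (f t * Y ω) ∂(timeMeasure T) ∂P := by
        refine integral_congr_ae (.of_forall fun ω => ?_)
        simp only [← integral_mul_const, map_mul, mul_assoc]
    _ = _ := by
        rw [← hswap]
        refine integral_congr_ae (.of_forall fun t => ?_)
        simp only [← integral_mul_const, map_mul]
        refine integral_congr_ae (.of_forall fun ω => ?_)
        simp only
        ring

/-- The covariance operator of the process on signals. -/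
def covarianceOperator (hx : IsContinuousCovarianceProcess P T x) :
    SignalSpace T →L[ℂ] SignalSpace T :=
  ContinuousLinearMap.adjoint (sampleOperator hx) ∘L sampleOperator hx

theorem inner_covarianceOperator (hx : IsContinuousCovarianceProcess P T x)
    (f g : SignalSpace T) :
    inner ℂ f (covarianceOperator hx g)
      = ∫ ω, signalSample x f ω * conj (signalSample x g ω) ∂P := by
  rw [covarianceOperator, ContinuousLinearMap.comp_apply, ContinuousLinearMap.adjoint_inner_right,
    inner_sampleOperator]

/-- The covariance operator is the integral operator with kernel the autocorrelation function. -/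
theorem covarianceOperator_ae_eq (hx : IsContinuousCovarianceProcess P T x) (g : SignalSpace T) :
    covarianceOperator hx g =ᵐ[timeMeasure T]
      fun t => ∫ η, autocorrelation P x t η * g η ∂(timeMeasure T) := by
  have hk := memLp_integral_autocorrelation hx g
  suffices h : covarianceOperator hx g = hk.toLp _ by
    rw [h]; exact hk.coeFn_toLp
  refine ext_inner_left ℂ fun f => ?_
  rw [inner_covarianceOperator, inner_toLp_right,
    integral_signalSample_mul_conj hx f (hx.memLp_signalSample g)]
  refine integral_congr_ae ?_
  filter_upwards [ae_timeMeasure_mem T] with t ht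
  congr 1
  -- A second exchange of integrals, now for the sample against `g`; conjugation brings it to the
  -- required form.
  calc ∫ ω, x t ω * conj (signalSample x g ω) ∂P
      = conj (∫ ω, signalSample x g ω * conj (x t ω) ∂P) := by
        rw [← integral_conj]
        exact integral_congr_ae (.of_forall fun ω => by simp [mul_comm])
    _ = _ := by
        rw [integral_signalSample_mul_conj hx g (hx.memLp t ht), ← integral_conj]
        refine integral_congr_ae (.of_forall fun η => ?_)
        change conj (autocorrelation P x η t * conj (g η)) = _
        rw [map_mul, conj_autocorrelation, Complex.conj_conj]

theorem isPositive_covarianceOperator (hx : IsContinuousCovarianceProcess P T x) :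
    (covarianceOperator hx).IsPositive :=
  ContinuousLinearMap.isPositive_adjoint_comp_self _

end Covariance

/-! ### Moments of the noisy samples and the mean-squared error. -/

section Noise

theorem integral_mul_conj_symm {Ω : Type*} [MeasurableSpace Ω] {P : Measure Ω}
    (X Y : Ω → ℂ) :
    ∫ ω, X ω * conj (Y ω) ∂P = conj (∫ ω, Y ω * conj (X ω) ∂P) := by
  rw [← integral_conj]
  exact integral_congr_ae (.of_forall fun ω => by simp [mul_comm])

theorem noisySample_eq {Ω : Type*} {T : ℝ} (x : ℝ → Ω → ℂ)
    (w : SignalSpace T → Ω → ℂ) (f : SignalSpace T)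
    (ω : Ω) : noisySample x w f ω = signalSample x f ω + w f ω := rfl

variable {Ω : Type*} [MeasurableSpace Ω] {P : Measure Ω} [IsProbabilityMeasure P] {T σ : ℝ}
  {x : ℝ → Ω → ℂ} {w : SignalSpace T → Ω → ℂ}

/-- A Hilbert space realization of the covariance of the noisy samples. -/
def noisySampleOperator (hx : IsContinuousCovarianceProcess P T x) (σ : ℝ) :
    SignalSpace T →ₗ[ℂ] WithLp 2 (Lp ℂ 2 P × SignalSpace T) :=
  (WithLp.linearEquiv 2 ℂ (Lp ℂ 2 P × SignalSpace T)).symm.toLinearMap ∘ₗ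
    (sampleOperator hx).toLinearMap.prod ((σ : ℂ) • LinearMap.id)

/-- The noise is modelled by a separate orthogonal coordinate `σ f`. This gives a linear map
although `w` is not assumed linear in `f`. -/
theorem inner_noisySampleOperator (hx : IsContinuousCovarianceProcess P T x)
    (f g : SignalSpace T) :
    inner ℂ (noisySampleOperator hx σ f) (noisySampleOperator hx σ g)
      = inner ℂ f (covarianceOperator hx g) + (σ : ℂ) ^ 2 * inner ℂ f g := by
  rw [WithLp.prod_inner_apply, inner_covarianceOperator, ← inner_sampleOperator]
  change _ + inner ℂ ((σ : ℂ) • f) ((σ : ℂ) • g) = _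
  rw [inner_smul_left, inner_smul_right, Complex.conj_ofReal, ← mul_assoc, sq]
  rfl

theorem integral_signalSample_mul_conj_noise (hx : IsContinuousCovarianceProcess P T x)
    (hw : IsWhiteNoise P T σ w) (hxw : ∀ t ∈ Icc (0 : ℝ) T, ∀ f, Uncorrelated P (x t) (w f))
    (f g : SignalSpace T) : ∫ ω, signalSample x f ω * conj (w g ω) ∂P = 0 := by
  rw [integral_signalSample_mul_conj hx f (hw.memLp g)]
  refine integral_eq_zero_of_ae ?_
  filter_upwards [ae_timeMeasure_mem T] with t ht
  rw [hxw t ht g, hx.mean_zero t ht]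
  simp

theorem memLp_noisySample (hx : IsContinuousCovarianceProcess P T x)
    (hw : IsWhiteNoise P T σ w) (f : SignalSpace T) : MemLp (noisySample x w f) 2 P :=
  (hx.memLp_signalSample f).add (hw.memLp f)

theorem integral_noisySample_mul_conj_signalSample (hx : IsContinuousCovarianceProcess P T x)
    (hw : IsWhiteNoise P T σ w) (hxw : ∀ t ∈ Icc (0 : ℝ) T, ∀ f, Uncorrelated P (x t) (w f))
    (f g : SignalSpace T) :
    ∫ ω, noisySample x w f ω * conj (signalSample x g ω) ∂P
      = inner ℂ f (covarianceOperator hx g) := by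
  simp only [noisySample_eq, add_mul]
  rw [integral_add (integrable_mul_conj (hx.memLp_signalSample f) (hx.memLp_signalSample g))
      (integrable_mul_conj (hw.memLp f) (hx.memLp_signalSample g)),
    integral_mul_conj_symm (w f), integral_signalSample_mul_conj_noise hx hw hxw,
    inner_covarianceOperator, map_zero, add_zero]

theorem integral_noisySample_mul_conj (hx : IsContinuousCovarianceProcess P T x)
    (hw : IsWhiteNoise P T σ w) (hxw : ∀ t ∈ Icc (0 : ℝ) T, ∀ f, Uncorrelated P (x t) (w f))
    (f g : SignalSpace T) :
    ∫ ω, noisySample x w f ω * conj (noisySample x w g ω) ∂P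
      = inner ℂ (noisySampleOperator hx σ f) (noisySampleOperator hx σ g) := by
  have hY := memLp_noisySample hx hw f
  simp only [noisySample_eq x w g, map_add, mul_add]
  rw [integral_add (integrable_mul_conj hY (hx.memLp_signalSample g))
      (integrable_mul_conj hY (hw.memLp g)),
    integral_noisySample_mul_conj_signalSample hx hw hxw, inner_noisySampleOperator]
  congr 1
  simp only [noisySample_eq, add_mul]
  rw [integral_add (integrable_mul_conj (hx.memLp_signalSample f) (hw.memLp g))
      (integrable_mul_conj (hw.memLp f) (hw.memLp g)),
    integral_signalSample_mul_conj_noise hx hw hxw, hw.covariance, zero_add]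

/-- On almost every path the squared error is `‖a - X‖²` with `a` the estimate; expand it and take
expectations. -/
theorem meanSquaredError_eq (hx : IsContinuousCovarianceProcess P T x)
    (hw : IsWhiteNoise P T σ w) (hxw : ∀ t ∈ Icc (0 : ℝ) T, ∀ f, Uncorrelated P (x t) (w f))
    {N : ℕ} (s v : Fin N → SignalSpace T) :
    meanSquaredError P x w s v = ENNReal.ofReal (∫ ω, pathEnergy T x ω ∂P
      + excessError (covarianceOperator hx) (noisySampleOperator hx σ) s v) := by
  have hi1 : ∀ n m, Integrable (fun ω => noisySample x w (s n) ω *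
      conj (noisySample x w (s m) ω) * inner ℂ (v m) (v n)) P := fun n m =>
    (integrable_mul_conj (memLp_noisySample hx hw _) (memLp_noisySample hx hw _)).mul_const _
  have hi2 : ∀ n, Integrable (fun ω => noisySample x w (s n) ω *
      conj (signalSample x (v n) ω)) P := fun n =>
    integrable_mul_conj (memLp_noisySample hx hw _) (hx.memLp_signalSample _)
  let A : Ω → ℂ := fun ω => ∑ n, ∑ m, noisySample x w (s n) ω *
      conj (noisySample x w (s m) ω) * inner ℂ (v m) (v n)
  let B : Ω → ℂ := fun ω => ∑ n, noisySample x w (s n) ω * conj (signalSample x (v n) ω)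
  have hA : Integrable A P := integrable_finsetSum _ fun n _ => integrable_finsetSum _ fun m _ =>
    hi1 n m
  have hB : Integrable B P := integrable_finsetSum _ fun n _ => hi2 n
  have hAi : ∫ ω, A ω ∂P = ∑ n, ∑ m, inner ℂ (noisySampleOperator hx σ (s n))
      (noisySampleOperator hx σ (s m)) * inner ℂ (v m) (v n) := by
    simp only [A]
    rw [integral_finsetSum _ fun n _ => integrable_finsetSum _ fun m _ => hi1 n m]
    refine Finset.sum_congr rfl fun n _ => ?_
    rw [integral_finsetSum _ fun m _ => hi1 n m]
    refine Finset.sum_congr rfl fun m _ => ?_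
    rw [integral_mul_const, integral_noisySample_mul_conj hx hw hxw]
  have hBi : ∫ ω, B ω ∂P = ∑ n, inner ℂ (s n) (covarianceOperator hx (v n)) := by
    simp only [B]
    rw [integral_finsetSum _ fun n _ => hi2 n]
    exact Finset.sum_congr rfl fun n _ =>
      integral_noisySample_mul_conj_signalSample hx hw hxw _ _
  let G : Ω → ℝ := fun ω => pathEnergy T x ω + ((A ω).re - 2 * (B ω).re)
  have hG : Integrable G P :=
    hx.integrable_pathEnergy.add (hA.re.sub (hB.re.const_mul 2))
  have hGi : ∫ ω, G ω ∂P = ∫ ω, pathEnergy T x ω ∂P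
      + excessError (covarianceOperator hx) (noisySampleOperator hx σ) s v := by
    have hre : ∀ {C : Ω → ℂ}, Integrable C P → ∫ ω, (C ω).re ∂P = (∫ ω, C ω ∂P).re :=
      fun h => integral_re h
    have hAr : Integrable (fun ω => (A ω).re) P := hA.re
    have hBr : Integrable (fun ω => 2 * (B ω).re) P := hB.re.const_mul 2
    have hAB : Integrable (fun ω => (A ω).re - 2 * (B ω).re) P := hAr.sub hBr
    simp only [G]
    rw [integral_add hx.integrable_pathEnergy hAB, integral_sub hAr hBr, integral_const_mul,
      excessError, ← hAi, ← hBi, hre hA, hre hB]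
  -- Nonnegativity of `G` is recorded to pass from the Bochner integral to the Lebesgue one.
  have key : ∀ᵐ ω ∂P, ∫⁻ t, ‖linearEstimate x w s v t ω - x t ω‖ₑ ^ 2 ∂(timeMeasure T)
      = ENNReal.ofReal (G ω) ∧ 0 ≤ G ω := by
    filter_upwards [hx.ae_exists_path] with ω ⟨X, hXx, hX, hE⟩
    let a : SignalSpace T := ∑ n, noisySample x w (s n) ω • v n
    have hGa : G ω = ‖a - X‖ ^ 2 := by
      have h1 : (inner ℂ a a).re = (A ω).re := by
        congr 1
        simp only [a, A, inner_sum, sum_inner, inner_smul_left, inner_smul_right]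
        refine Finset.sum_congr rfl fun n _ => ?_
        rw [Finset.mul_sum]
        refine Finset.sum_congr rfl fun m _ => ?_
        ring
      have h2 : (inner ℂ a X).re = (B ω).re := by
        rw [← Complex.conj_re, inner_conj_symm]
        congr 1
        simp only [a, B, inner_sum, inner_smul_right, hX, inner_conj_symm]
      have h3 := norm_sub_sq (𝕜 := ℂ) a X
      have h4 : (inner ℂ a a).re = ‖a‖ ^ 2 := inner_self_eq_norm_sq (𝕜 := ℂ) a
      rw [← h4] at h3
      change _ = (inner ℂ a a).re - 2 * (inner ℂ a X).re + _ at h3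
      rw [h3, h1, h2, ← hE]
      simp only [G]
      ring
    refine ⟨?_, hGa ▸ by positivity⟩
    rw [hGa, ← lintegral_enorm_sq_eq]
    refine lintegral_congr_ae ?_
    have ha : a =ᵐ[timeMeasure T] fun t => ∑ n, noisySample x w (s n) ω * v n t := by
      have h5 : ∀ᵐ t ∂(timeMeasure T), ∀ n,
          (noisySample x w (s n) ω • v n : SignalSpace T) t = noisySample x w (s n) ω * v n t := by
        rw [ae_all_iff]
        intro n
        filter_upwards [Lp.coeFn_smul (noisySample x w (s n) ω) (v n)] with t ht
        rw [ht, Pi.smul_apply, smul_eq_mul]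
      have h6 := Lp.coeFn_finsetSum (Finset.univ) fun n => noisySample x w (s n) ω • v n
      filter_upwards [h5, h6] with t h5 h6
      rw [h6, Finset.sum_apply]
      exact Finset.sum_congr rfl fun n _ => h5 n
    filter_upwards [Lp.coeFn_sub a X, ha, hXx] with t h7 h8 h9
    rw [h7, Pi.sub_apply, h8, h9, linearEstimate]
  rw [meanSquaredError, ← hGi, ofReal_integral_eq_lintegral_ofReal hG (key.mono fun _ h => h.2)]
  exact lintegral_congr_ae (key.mono fun _ h => h.1)

theorem exists_isOrderedEigensystem (hT : 0 < T) (hx : IsContinuousCovarianceProcess P T x) :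
    ∃ (ψ : ℕ → SignalSpace T) (lam : ℕ → ℝ),
      IsOrderedEigensystem T (autocorrelation P x) ψ lam := by
  obtain ⟨ψ, l, h1, h2, h3, h4⟩ := exists_antitone_eigensystem
    (not_finiteDimensional_signalSpace hT) (sampleOperator hx) (sum_norm_sampleOperator_sq_le hx)
  refine ⟨ψ, l, h1, fun k => ?_, h3, fun f hf => ?_⟩
  · have h := covarianceOperator_ae_eq hx (ψ k)
    rw [show covarianceOperator hx (ψ k) = (l k : ℂ) • ψ k from h2 k] at h
    filter_upwards [h, Lp.coeFn_smul (l k : ℂ) (ψ k)] with t h5 h6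
    rw [← h5, h6, Pi.smul_apply, smul_eq_mul]
  · have h := covarianceOperator_ae_eq hx f
    rw [show covarianceOperator hx f = 0 from h4 f hf] at h
    filter_upwards [h, Lp.coeFn_zero ℂ 2 (timeMeasure T)] with t h5 h6
    rw [← h5, h6, Pi.zero_apply]

theorem IsOrderedEigensystem.covarianceOperator_apply (hx : IsContinuousCovarianceProcess P T x)
    {ψ : ℕ → SignalSpace T} {lam : ℕ → ℝ}
    (h : IsOrderedEigensystem T (autocorrelation P x) ψ lam) (k : ℕ) :
    covarianceOperator hx (ψ k) = (lam k : ℂ) • ψ k := by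
  refine Lp.ext ?_
  filter_upwards [covarianceOperator_ae_eq hx (ψ k), h.eigen k,
    Lp.coeFn_smul (lam k : ℂ) (ψ k)] with t h1 h2 h3
  rw [h1, h2, h3, Pi.smul_apply, smul_eq_mul]

theorem IsOrderedEigensystem.covarianceOperator_eq_zero
    (hx : IsContinuousCovarianceProcess P T x) {ψ : ℕ → SignalSpace T} {lam : ℕ → ℝ}
    (h : IsOrderedEigensystem T (autocorrelation P x) ψ lam) (f : SignalSpace T)
    (hf : ∀ k, inner ℂ (ψ k) f = 0) : covarianceOperator hx f = 0 := by
  refine Lp.ext ?_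
  filter_upwards [covarianceOperator_ae_eq hx f, h.complete f hf,
    Lp.coeFn_zero ℂ 2 (timeMeasure T)] with t h1 h2 h3
  rw [h1, h2, h3, Pi.zero_apply]

end Noise

end LinearSampling

end

theorem theorem4 {Ω : Type*} [MeasurableSpace Ω] (P : Measure Ω) [IsProbabilityMeasure P]
    (T : ℝ) (hT : 0 < T) (σ : ℝ) (hσ : 0 < σ)
    (x : ℝ → Ω → ℂ) (hx : LinearSampling.IsContinuousCovarianceProcess P T x)
    (w : LinearSampling.SignalSpace T → Ω → ℂ) (hw : LinearSampling.IsWhiteNoise P T σ w)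
    (hxw : ∀ t ∈ Icc (0 : ℝ) T, ∀ f, LinearSampling.Uncorrelated P (x t) (w f)) :
    (∃ (ψ : ℕ → LinearSampling.SignalSpace T) (lam : ℕ → ℝ),
      LinearSampling.IsOrderedEigensystem T (LinearSampling.autocorrelation P x) ψ lam) ∧
    ∀ (ψ : ℕ → LinearSampling.SignalSpace T) (lam : ℕ → ℝ),
      LinearSampling.IsOrderedEigensystem T (LinearSampling.autocorrelation P x) ψ lam →
      ∀ N : ℕ,
        LinearSampling.meanSquaredError P x w
            (LinearSampling.optimalSampling σ ψ lam N)
            (LinearSampling.optimalReconstruction σ ψ lam N) < ∞ ∧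
        ∀ s v : Fin N → LinearSampling.SignalSpace T,
          LinearSampling.meanSquaredError P x w
              (LinearSampling.optimalSampling σ ψ lam N)
              (LinearSampling.optimalReconstruction σ ψ lam N) ≤
            LinearSampling.meanSquaredError P x w s v := by
  refine ⟨LinearSampling.exists_isOrderedEigensystem hT hx, fun ψ lam h N => ?_⟩
  have hK := LinearSampling.isPositive_covarianceOperator hx
  have hev := h.covarianceOperator_apply hx
  have hΦ := LinearSampling.inner_noisySampleOperator (σ := σ) hx
  refine ⟨?_, fun s v => ?_⟩
  · rw [LinearSampling.meanSquaredError_eq hx hw hxw]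
    exact ENNReal.ofReal_lt_top
  · rw [LinearSampling.meanSquaredError_eq hx hw hxw, LinearSampling.meanSquaredError_eq hx hw hxw]
    refine ENNReal.ofReal_le_ofReal (add_le_add_right ?_ _)
    exact (LinearSampling.excessError_optimal hK hσ hΦ h.orthonormal hev N).le.trans
      (LinearSampling.neg_sum_le_excessError hK hσ hΦ h.orthonormal hev h.antitone
        (h.covarianceOperator_eq_zero hx) s v)
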